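/- Let $R$ be a noetherian commutative ring and let $R[[t]][x]=R[[t]][x_1,\dots,x_n]$. A monomial ordering $>$ is a total ordering on the monomials $t^\beta x^\alpha$ ($\beta\in\mathbb N$, $\alpha\in\mathbb N^n$) compatible with multiplication; it is called $t$-local if $1>t$. For such a $>$ and $0\neq f\in R[[t]][x]$, the leading term $\operatorname{lt}_>(f)$ is the term of $f$ whose monomial is greatest with respect to $>$; also $\operatorname{lt}_>(0)=0$ and $\operatorname{tail}_>(f)=f-\operatorname{lt}_>(f)$. For a subset $S$ of $R[[t]][x]$ (or of $R[t,x]\subseteq R[[t]][x]$) let $\operatorname{lt}_>(S)$ denote the ideal of $R[t,x]$ generated by the leading terms of the elements of $S$. For an ideal $I$ of $R[[t]][x]$ or of $R[t,x]$, a standard basis of $I$ with respect to $>$ is a finite subset $G\subseteq I$ with $\operatorname{lt}_>(G)=\operatorname{lt}_>(I)$. It is minimal if no proper subset of the set $\{\operatorname{lt}_>(g)\mid g\in G\}$ generates $\operatorname{lt}_>(I)$. It is initially reduced if it is minimal and if for every $g=\sum_\alpha g_\alpha x^\alpha\in G$ with $g_\alpha\in R[[t]]$, setting $g'=\sum_\alpha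 \operatorname{lt}_>(g_\alpha)\,x^\alpha$, no nonzero term of $\operatorname{tail}_>(g')$ lies in $\operatorname{lt}_>(G)$. For $w=(w_0,\dots,w_n)\in\mathbb R_{<0}\times\mathbb R^n$, the initial form $\operatorname{in}_w(f)\in R[t,x]$ of $f\in R[[t]][x]$ is the sum of the terms of $f$ whose exponent $(\beta,\alpha)$ has maximal $w\cdot(\beta,\alpha)$, and $\operatorname{in}_w(I)$ is the ideal of $R[t,x]$ generated by all $\operatorname{in}_w(f)$, $f\in I$. Let $$C_>(I)=\overline{\{v\in\mathbb R_{<0}\times\mathbb R^n\mid \operatorname{in}_v(I)=\operatorname{lt}_>(I)\}},$$ the closure being taken in the Euclidean topology. **Proposition.** Let $I$ be an ideal of $R[[t]][x]$ generated by elements that are homogeneous in $x$, let $>$ be a $t$-local monomial ordering, and let $G$ be an initially reduced standard basis of $I$ with respect to $>$. Then for all $w\in C_>(I)$ with $w_0<0$ the set $$H=\{\operatorname{in}_w(g)\mid g\in G\}$$ is an initially reduced standard basis of $\operatorname{in}_w(I)$ with respect to the same ordering $>$. -/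

import Mathlib

namespace LocalGroebner

/-- Exponent vectors `(β, α)` of the monomials `t ^ β * x ^ α` in one variable `t` and `n` variables
`x`. Multiplication of monomials is addition of exponent vectors. -/
abbrev Expo (n : ℕ) : Type := ℕ × (Fin n →₀ ℕ)

/-- A monomial ordering: a strict total order `gt` on monomials (`gt a b` means `a > b`)
that is compatible with multiplication. No well-ordering is required, and no sign condition on the
variables `x`. -/
structure MonOrdering (n : ℕ) where
  gt : Expo n → Expo n → Prop
  irrefl : ∀ a, ¬ gt a a
  trans : ∀ a b c, gt a b → gt b c → gt a c
  total : ∀ a b, gt a b ∨ a = b ∨ gt b a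
  gt_mul : ∀ a b c, gt a b → gt (a + c) (b + c)

/-- The ordering is `t`-local if `1 > t`. -/
def MonOrdering.IsTLocal {n : ℕ} (ord : MonOrdering n) : Prop :=
  ord.gt (0, 0) (1, 0)

/-- The mixed power series polynomial ring `R⟦t⟧[x₁, …, xₙ]`. -/
abbrev Mixed (n : ℕ) (R : Type*) [CommRing R] := MvPolynomial (Fin n) (PowerSeries R)

/-- The polynomial ring `R[t, x₁, …, xₙ] = R[t][x₁, …, xₙ]`. -/
abbrev Poly (n : ℕ) (R : Type*) [CommRing R] := MvPolynomial (Fin n) (Polynomial R)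

section Basic

variable {n : ℕ} {R : Type*} [CommRing R]

/-- The inclusion of `R[t, x]` into `R⟦t⟧[x]`. -/
noncomputable def incl : Poly n R →+* Mixed n R :=
  MvPolynomial.map Polynomial.coeToPowerSeries.ringHom

/-- The coefficient of `t ^ β * x ^ α` in `f`. -/
noncomputable def cf (f : Mixed n R) (e : Expo n) : R :=
  PowerSeries.coeff e.1 (MvPolynomial.coeff e.2 f)

/-- The term `c * t ^ β * x ^ α`, as an element of `R[t, x]`. -/
noncomputable def term (e : Expo n) (c : R) : Poly n R :=
  MvPolynomial.monomial e.2 (Polynomial.monomial e.1 c)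

/-- `e` is the leading monomial of `f`: the greatest monomial that occurs in `f`. -/
def IsLeadingMon (ord : MonOrdering n) (f : Mixed n R) (e : Expo n) : Prop :=
  cf f e ≠ 0 ∧ ∀ e', cf f e' ≠ 0 → e' ≠ e → ord.gt e e'

open Classical in
/-- The leading term of `f`, with `lt 0 = 0`. For a `t`-local ordering every nonzero `f` has exactly
one leading monomial, see `exists_isLeadingMon` and `IsLeadingMon.unique`. -/
noncomputable def lt (ord : MonOrdering n) (f : Mixed n R) : Poly n R :=
  if h : ∃ e, IsLeadingMon ord f e then term h.choose (cf f h.choose) else 0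

/-- The tail of `f`. -/
noncomputable def tail (ord : MonOrdering n) (f : Mixed n R) : Mixed n R :=
  f - incl (lt ord f)

/-- The ideal of `R[t, x]` generated by the leading terms of the elements of a set `S`. The set may
be an ideal of `R⟦t⟧[x]`, the image in `R⟦t⟧[x]` of an ideal of `R[t, x]`, or a finite set. -/
noncomputable def ltIdeal (ord : MonOrdering n) (S : Set (Mixed n R)) : Ideal (Poly n R) :=
  Ideal.span (lt ord '' S)

/-- The weighted degree `w · (β, α)`. -/
noncomputable def wdeg (w : ℝ × (Fin n → ℝ)) (e : Expo n) : ℝ :=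
  w.1 * (e.1 : ℝ) + ∑ i, w.2 i * (e.2 i : ℝ)

/-- The monomials of `f` that have maximal weighted degree among the monomials of `f`. -/
def maxSupport (w : ℝ × (Fin n → ℝ)) (f : Mixed n R) : Set (Expo n) :=
  {e | cf f e ≠ 0 ∧ ∀ e', cf f e' ≠ 0 → wdeg w e' ≤ wdeg w e}

/-- The initial form `in_w(f)`: the sum of the terms of `f` of maximal weighted degree. It is used
for `w.1 < 0` only, where the sum is finite, see `maxSupport_finite`. -/
noncomputable def initialForm (w : ℝ × (Fin n → ℝ)) (f : Mixed n R) : Poly n R :=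
  ∑ᶠ e ∈ maxSupport w f, term e (cf f e)

/-- The initial ideal `in_w(I)`, an ideal of `R[t, x]`. -/
noncomputable def initialIdeal (w : ℝ × (Fin n → ℝ)) (I : Ideal (Mixed n R)) : Ideal (Poly n R) :=
  Ideal.span (initialForm w '' (I : Set (Mixed n R)))

/-- The cone `C_>(I)`: the closure of the set of weights `v` with `v₀ < 0` and
`in_v(I) = lt_>(I)`. -/
def groebnerCone (ord : MonOrdering n) (I : Ideal (Mixed n R)) : Set (ℝ × (Fin n → ℝ)) :=
  closure {v | v.1 < 0 ∧ initialIdeal v I = ltIdeal ord (I : Set (Mixed n R))}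

/-- An ideal is `x`-homogeneous if it is generated by `x`-homogeneous elements. -/
def IsXHomogeneous (I : Ideal (Mixed n R)) : Prop :=
  ∃ S : Set (Mixed n R), (∀ f ∈ S, ∃ d : ℕ, MvPolynomial.IsHomogeneous f d) ∧ I = Ideal.span S

/-- Writing `g = ∑ g_α * x ^ α` with `g_α ∈ R⟦t⟧`, this is `g' = ∑ lt_>(g_α) * x ^ α`. -/
noncomputable def slicewiseLt (ord : MonOrdering n) (g : Mixed n R) : Poly n R :=
  ∑ α ∈ g.support, lt ord (MvPolynomial.C (MvPolynomial.coeff α g)) * term (0, α) 1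

/-- `G` is reduced with respect to `H`: no term of the tail of an element of `G` lies in the ideal
generated by the leading terms of `H`. -/
def IsReducedWrt (ord : MonOrdering n) (G H : Set (Mixed n R)) : Prop :=
  ∀ g ∈ G, ∀ e, cf (tail ord g) e ≠ 0 → term e (cf (tail ord g) e) ∉ ltIdeal ord H

/-- `G` is initially reduced with respect to `H`: the set of all `g'`, `g ∈ G`, is reduced with
respect to `H`. -/
def IsInitiallyReducedWrt (ord : MonOrdering n) (G H : Set (Mixed n R)) : Prop :=
  IsReducedWrt ord ((fun g => incl (slicewiseLt ord g)) '' G) H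

/-- `G` is a standard basis of `S`, where `S` is an ideal of `R⟦t⟧[x]` or (the image in `R⟦t⟧[x]` of)
an ideal of `R[t, x]`: a finite subset whose leading terms generate the leading ideal. -/
def IsStandardBasis (ord : MonOrdering n) (G S : Set (Mixed n R)) : Prop :=
  G.Finite ∧ G ⊆ S ∧ ltIdeal ord G = ltIdeal ord S

/-- `G` is minimal: no proper subset of the set of leading terms of `G` generates the leading
ideal of `S`. -/
def IsMinimal (ord : MonOrdering n) (G S : Set (Mixed n R)) : Prop :=
  ∀ T, T ⊂ lt ord '' G → Ideal.span T ≠ ltIdeal ord S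

/-- `G` is an initially reduced standard basis of `S`: a standard basis that is minimal and
initially reduced with respect to itself. -/
def IsInitiallyReducedStandardBasis (ord : MonOrdering n) (G S : Set (Mixed n R)) : Prop :=
  IsStandardBasis ord G S ∧ IsMinimal ord G S ∧ IsInitiallyReducedWrt ord G G

theorem IsLeadingMon.unique {ord : MonOrdering n} {f : Mixed n R} {e e' : Expo n}
    (h : IsLeadingMon ord f e) (h' : IsLeadingMon ord f e') : e = e' := by
  by_contra hne
  exact ord.irrefl _ (ord.trans _ _ _ (h.2 e' h'.1 (Ne.symm hne)) (h'.2 e h.1 hne))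

theorem MonOrdering.IsTLocal.gt_of_lt {ord : MonOrdering n} (ht : ord.IsTLocal)
    {b c : ℕ} (h : b < c) (a : Fin n →₀ ℕ) : ord.gt (b, a) (c, a) := by
  induction c, h using Nat.le_induction with
  | base => simpa [add_comm] using ord.gt_mul _ _ (b, a) ht
  | succ c _ ih =>
    exact ord.trans _ _ _ ih (by simpa [add_comm] using ord.gt_mul _ _ (c, a) ht)

/-- For a `t`-local ordering every nonzero element has a leading monomial. -/
theorem exists_isLeadingMon {ord : MonOrdering n} (ht : ord.IsTLocal) {f : Mixed n R}
    (hf : f ≠ 0) : ∃ e, IsLeadingMon ord f e := by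
  classical
  let E : Finset (Expo n) := f.support.image
    fun α => ((MvPolynomial.coeff α f).order.toNat, α)
  have hE : E.Nonempty := by
    simpa [E] using hf
  have key : ∀ F : Finset (Expo n), F.Nonempty →
      ∃ e ∈ F, ∀ e' ∈ F, e' ≠ e → ord.gt e e' := by
    intro F hF
    induction hF using Finset.Nonempty.cons_induction with
    | singleton a => exact ⟨a, by simp, by simp⟩
    | cons a s _ _ ih =>
      obtain ⟨e, he, hmax⟩ := ih
      rcases ord.total a e with h | h | h
      · refine ⟨a, by simp, fun e' he' hne => ?_⟩
        rcases Finset.mem_cons.1 he' with rfl | he'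
        · exact absurd rfl hne
        · by_cases hee : e' = e
          · exact hee ▸ h
          · exact ord.trans _ _ _ h (hmax e' he' hee)
      · exact absurd (h ▸ he) ‹_›
      · refine ⟨e, by simp [he], fun e' he' hne => ?_⟩
        rcases Finset.mem_cons.1 he' with rfl | he'
        · exact h
        · exact hmax e' he' hne
  obtain ⟨e, he, hmax⟩ := key E hE
  obtain ⟨α, hα, rfl⟩ := Finset.mem_image.1 he
  have hα' : MvPolynomial.coeff α f ≠ 0 := by simpa using hα
  refine ⟨((MvPolynomial.coeff α f).order.toNat, α), PowerSeries.coeff_order hα', fun e' he' hne => ?_⟩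
  obtain ⟨b, a⟩ := e'
  have ha : MvPolynomial.coeff a f ≠ 0 := fun h0 => he' (by simp [cf, h0])
  have hle : (MvPolynomial.coeff a f).order.toNat ≤ b :=
    ENat.toNat_le_of_le_natCast (PowerSeries.order_le b he')
  have hmem : ((MvPolynomial.coeff a f).order.toNat, a) ∈ E :=
    Finset.mem_image.2 ⟨a, by simpa using ha, rfl⟩
  by_cases hEq : ((MvPolynomial.coeff a f).order.toNat, a) =
      ((MvPolynomial.coeff α f).order.toNat, α)
  · rcases hle.lt_or_eq with hlt | heq
    · rw [← hEq]; exact ht.gt_of_lt hlt a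
    · exact absurd (heq ▸ hEq) hne
  · rcases hle.lt_or_eq with hlt | heq
    · exact ord.trans _ _ _ (hmax _ hmem hEq) (ht.gt_of_lt hlt a)
    · exact heq ▸ hmax _ hmem hEq

/-- For `w₀ < 0` only finitely many monomials of `f` have maximal weighted degree. -/
theorem maxSupport_finite {w : ℝ × (Fin n → ℝ)} (hw : w.1 < 0) (f : Mixed n R) :
    (maxSupport w f).Finite := by
  classical
  refine Set.Finite.of_finite_image (f := Prod.snd) (f.support.finite_toSet.subset ?_) ?_
  · rintro _ ⟨e, he, rfl⟩
    have : MvPolynomial.coeff e.2 f ≠ 0 := fun h0 => he.1 (by simp [cf, h0])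
    simpa using this
  · rintro ⟨b, a⟩ hb ⟨c, a'⟩ hc h
    obtain rfl : a = a' := h
    have h1 := le_antisymm (hb.2 _ hc.1) (hc.2 _ hb.1)
    simp only [wdeg, add_left_inj] at h1
    have h2 := mul_left_cancel₀ hw.ne h1
    have h3 : c = b := by exact_mod_cast h2
    rw [h3]

end Basic

end LocalGroebner

open LocalGroebner

/-! Since `1 > t` and `w₀ < 0`, ordering and weight both prefer small powers of `t`: leading
monomials and monomials of maximal weight are lowest in their slice `g_α x^α`. Initial reducedness
controls exactly these lowest terms: apart from the leading term of `g`, none lies in lt(G). This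
has two consequences. Elements of `G` are `x`-homogeneous, since the leading term of another
homogeneous component would be such a term in lt(I) = lt(G). And if in_v(I) = lt(I), the terms of
in_v(g) lie in lt(G), so in_v(g) is the leading term of `g`; by continuity the leading monomial has
maximal weight for every `w` in the cone. So in_w(g) and `g` share their leading term, and
minimality and reducedness pass to `H`.

It remains to see that lt(in_w(I)) lies in lt(G). A leading term of in_w(I) is the leading term of
some `x`-homogeneous `f ∈ I` for the ordering refining `w` by `ord`. If it is not in lt(G), reduce
`f` by `G` along the weighted ordering, for which `G` has the same leading terms. In a fixed
`x`-degree each monomial has only finitely many above it, so the reduction converges `t`-adically to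
some `r ≠ 0` without terms in lt(G). Krull's intersection theorem gives `r ∈ I`, so the
`ord`-leading term of `r` lies in lt(G), a contradiction
(`term_mem_ltIdeal_of_isLeadingMon_weighted`). -/

namespace LocalGroebner

variable {n : ℕ} {R : Type*} [CommRing R]

/-! ### Coefficients, terms and ideals generated by terms -/

/-- The coefficient of a monomial, as an additive map. -/
noncomputable def cfHom (e : Expo n) : Mixed n R →+ R where
  toFun f := cf f e
  map_zero' := by simp [cf]
  map_add' f g := by simp [cf]

@[simp] theorem cf_zero (e : Expo n) : cf (0 : Mixed n R) e = 0 := (cfHom e).map_zero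

@[simp] theorem cf_add (f g : Mixed n R) (e : Expo n) : cf (f + g) e = cf f e + cf g e :=
  (cfHom e).map_add f g

@[simp] theorem cf_sub (f g : Mixed n R) (e : Expo n) : cf (f - g) e = cf f e - cf g e :=
  (cfHom e).map_sub f g

theorem cf_sum {ι : Type*} (s : Finset ι) (f : ι → Mixed n R) (e : Expo n) :
    cf (∑ i ∈ s, f i) e = ∑ i ∈ s, cf (f i) e :=
  map_sum (cfHom e) f s

theorem mixed_ext {f g : Mixed n R} (h : ∀ e, cf f e = cf g e) : f = g := by
  ext a b
  exact h (b, a)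

theorem incl_injective : Function.Injective (incl : Poly n R → Mixed n R) :=
  MvPolynomial.map_injective _ (Polynomial.coe_injective R)

theorem cf_incl_term (e e' : Expo n) (c : R) :
    cf (incl (term e c)) e' = if e = e' then c else 0 := by
  obtain ⟨b, a⟩ := e
  obtain ⟨b', a'⟩ := e'
  simp only [cf, incl, term, MvPolynomial.map_monomial, MvPolynomial.coeff_monomial,
    Polynomial.coeToPowerSeries.ringHom_apply, Prod.mk.injEq]
  by_cases ha : a = a'
  · simp [ha, PowerSeries.coeff_monomial, eq_comm]
  · simp [ha]

theorem term_zero (e : Expo n) : term e (0 : R) = 0 := by simp [term]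

theorem term_add (e : Expo n) (c c' : R) : term e (c + c') = term e c + term e c' := by
  simp [term]

theorem term_mul_term (e e' : Expo n) (c c' : R) :
    term e c * term e' c' = term (e + e') (c * c') := by
  simp [term, MvPolynomial.monomial_mul, Polynomial.monomial_mul_monomial]

theorem cf_term_mul_add (e e' : Expo n) (c : R) (f : Mixed n R) :
    cf (incl (term e c) * f) (e + e') = c * cf f e' := by
  simp only [cf, incl, term, MvPolynomial.map_monomial, Prod.fst_add, Prod.snd_add,
    MvPolynomial.coeff_monomial_mul, Polynomial.coeToPowerSeries.ringHom_apply,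
    Polynomial.coe_monomial]
  rw [PowerSeries.monomial_eq_C_mul_X_pow, mul_assoc, PowerSeries.coeff_C_mul]
  rw [add_comm, PowerSeries.coeff_X_pow_mul]

theorem exists_of_cf_term_mul_ne_zero {e e' : Expo n} {c : R} {f : Mixed n R}
    (h : cf (incl (term e c) * f) e' ≠ 0) : ∃ e'', e' = e + e'' := by
  simp only [cf, incl, term, MvPolynomial.map_monomial,
    MvPolynomial.coeff_monomial_mul', Polynomial.coeToPowerSeries.ringHom_apply,
    Polynomial.coe_monomial] at h
  split_ifs at h with ha
  · rw [PowerSeries.monomial_eq_C_mul_X_pow, mul_assoc, PowerSeries.coeff_C_mul,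
      PowerSeries.coeff_X_pow_mul'] at h
    split_ifs at h with hb
    · exact ⟨(e'.1 - e.1, e'.2 - e.2), Prod.ext (by simp [hb]) (by simp [ha])⟩
    · simp at h
  · simp at h

/-- Induction for polynomials in `t` and `x` by terms. -/
theorem poly_induction {P : Poly n R → Prop} (hadd : ∀ p q, P p → P q → P (p + q))
    (hterm : ∀ e c, P (term e c)) (p : Poly n R) : P p := by
  induction p using MvPolynomial.induction_on' with
  | monomial a q =>
    induction q using Polynomial.induction_on' with
    | add q r hq hr => simpa using hadd _ _ hq hr
    | monomial b c => exact hterm (b, a) c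
  | add p q hp hq => exact hadd _ _ hp hq

/-- Induction for an ideal of polynomials in `t` and `x`, multiplying by terms only. -/
theorem span_term_induction {S : Set (Poly n R)} {P : Poly n R → Prop}
    (hmem : ∀ s ∈ S, P s) (hzero : P 0) (hadd : ∀ p q, P p → P q → P (p + q))
    (hterm : ∀ e c p, P p → P (term e c * p)) {p : Poly n R} (hp : p ∈ Ideal.span S) : P p := by
  induction hp using Submodule.span_induction with
  | mem s hs => exact hmem s hs
  | zero => exact hzero
  | add p q _ _ hp hq => exact hadd p q hp hq
  | smul a p _ hp =>
    rw [smul_eq_mul]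
    induction a using poly_induction with
    | hadd a b ha hb => rw [add_mul]; exact hadd _ _ ha hb
    | hterm e c => exact hterm e c p hp

/-- An ideal generated by terms contains the terms of its elements. -/
theorem term_mem_of_mem_span {S : Set (Poly n R)} (hS : ∀ s ∈ S, ∃ e c, s = term e c)
    {p : Poly n R} (hp : p ∈ Ideal.span S) (e : Expo n) :
    term e (cf (incl p) e) ∈ Ideal.span S := by
  refine span_term_induction (P := fun p => ∀ e, term e (cf (incl p) e) ∈ Ideal.span S)
    ?_ ?_ ?_ ?_ hp e
  · intro s hs e
    obtain ⟨e', c, rfl⟩ := hS s hs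
    rw [cf_incl_term]
    split_ifs with h
    · exact h ▸ Ideal.subset_span hs
    · simp [term_zero]
  · simp [term_zero]
  · intro p q hp hq e
    rw [map_add, cf_add, term_add]
    exact add_mem (hp e) (hq e)
  · intro e' c p hp e
    by_cases h : cf (incl (term e' c * p)) e = 0
    · rw [h, term_zero]
      exact zero_mem _
    · rw [map_mul] at h
      obtain ⟨e'', rfl⟩ := exists_of_cf_term_mul_ne_zero h
      rw [map_mul, cf_term_mul_add, ← term_mul_term]
      exact Ideal.mul_mem_left _ _ (hp e'')

/-! ### Leading terms -/

section LeadingTerm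

variable {ord : MonOrdering n} {f : Mixed n R} {e : Expo n}

theorem IsLeadingMon.lt_eq (h : IsLeadingMon ord f e) : lt ord f = term e (cf f e) := by
  have hex : ∃ e, IsLeadingMon ord f e := ⟨e, h⟩
  rw [lt, dif_pos hex, hex.choose_spec.unique h]

theorem lt_zero : lt ord (0 : Mixed n R) = 0 := by
  rw [lt, dif_neg]
  rintro ⟨e, he⟩
  exact he.1 (cf_zero e)

theorem exists_lt_eq_term (f : Mixed n R) : ∃ e c, lt ord f = term e c := by
  by_cases h : ∃ e, IsLeadingMon ord f e
  · exact ⟨_, _, h.choose_spec.lt_eq⟩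
  · exact ⟨0, 0, by rw [lt, dif_neg h, term_zero]⟩

theorem IsLeadingMon.cf_tail (h : IsLeadingMon ord f e) (e' : Expo n) :
    cf (tail ord f) e' = if e' = e then 0 else cf f e' := by
  rw [tail, cf_sub, h.lt_eq, cf_incl_term]
  by_cases he : e' = e
  · simp [he]
  · simp [he, Ne.symm he]

theorem IsLeadingMon.congr {g : Mixed n R} (h : IsLeadingMon ord f e) (he : cf g e = cf f e)
    (hle : ∀ e', cf g e' ≠ 0 → cf f e' ≠ 0) : IsLeadingMon ord g e :=
  ⟨he ▸ h.1, fun e' he' hne => h.2 e' (hle e' he') hne⟩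

theorem term_mem_ltIdeal {S : Set (Mixed n R)} {p : Poly n R} (hp : p ∈ ltIdeal ord S)
    (e : Expo n) : term e (cf (incl p) e) ∈ ltIdeal ord S :=
  term_mem_of_mem_span (by rintro _ ⟨f, -, rfl⟩; exact exists_lt_eq_term f) hp e

theorem IsLeadingMon.term_mem_ltIdeal {S : Set (Mixed n R)} (h : IsLeadingMon ord f e)
    (hf : f ∈ S) : term e (cf f e) ∈ ltIdeal ord S :=
  h.lt_eq ▸ Ideal.subset_span ⟨f, hf, rfl⟩

end LeadingTerm

/-! ### Weighted degrees and weighted orderings -/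

section Weights

variable {w : ℝ × (Fin n → ℝ)}

theorem wdeg_add (w : ℝ × (Fin n → ℝ)) (e e' : Expo n) :
    wdeg w (e + e') = wdeg w e + wdeg w e' := by
  simp only [wdeg, Prod.fst_add, Prod.snd_add, Nat.cast_add, Finsupp.add_apply, mul_add,
    Finset.sum_add_distrib]
  ring

theorem wdeg_lt_wdeg (hw : w.1 < 0) {b c : ℕ} (h : b < c) (a : Fin n →₀ ℕ) :
    wdeg w (c, a) < wdeg w (b, a) := by
  have : (b : ℝ) < c := by exact_mod_cast h
  simp only [wdeg, add_lt_add_iff_right]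
  exact mul_lt_mul_of_neg_left this hw

theorem continuous_wdeg (e : Expo n) : Continuous fun w : ℝ × (Fin n → ℝ) => wdeg w e := by
  unfold wdeg
  fun_prop

open Classical in
theorem cf_incl_initialForm (hw : w.1 < 0) (f : Mixed n R) (e : Expo n) :
    cf (incl (initialForm w f)) e = if e ∈ maxSupport w f then cf f e else 0 := by
  rw [initialForm, finsum_mem_eq_finite_toFinset_sum _ (maxSupport_finite hw f), map_sum, cf_sum]
  simp only [cf_incl_term]
  rw [Finset.sum_ite_eq']
  simp

/-- The monomial ordering that compares weighted degrees first and breaks ties by `ord`. -/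
def MonOrdering.weighted (ord : MonOrdering n) (w : ℝ × (Fin n → ℝ)) : MonOrdering n where
  gt a b := wdeg w b < wdeg w a ∨ wdeg w b = wdeg w a ∧ ord.gt a b
  irrefl a h := by
    rcases h with h | h
    · exact lt_irrefl _ h
    · exact ord.irrefl a h.2
  trans a b c := by
    rintro (h | h) (h' | h')
    · exact Or.inl (h'.trans h)
    · exact Or.inl (h'.1.trans_lt h)
    · exact Or.inl (h'.trans_eq h.1)
    · exact Or.inr ⟨h'.1.trans h.1, ord.trans _ _ _ h.2 h'.2⟩
  total a b := by
    rcases lt_trichotomy (wdeg w a) (wdeg w b) with h | h | h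
    · exact Or.inr (Or.inr (Or.inl h))
    · rcases ord.total a b with h' | h' | h'
      · exact Or.inl (Or.inr ⟨h.symm, h'⟩)
      · exact Or.inr (Or.inl h')
      · exact Or.inr (Or.inr (Or.inr ⟨h, h'⟩))
    · exact Or.inl (Or.inl h)
  gt_mul a b c := by
    simp only [wdeg_add, add_lt_add_iff_right, add_left_inj]
    exact Or.imp_right (And.imp_right (ord.gt_mul a b c))

/-- There are finitely many `x`-exponents of degree `d`, and for each of them `w₀ < 0` bounds the
`t`-exponent. This is why reduction in a fixed `x`-degree can be indexed by natural numbers. -/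
theorem finite_setOf_wdeg_le (hw : w.1 < 0) (d : ℕ) (r : ℝ) :
    {e : Expo n | e.2.degree = d ∧ r ≤ wdeg w e}.Finite := by
  have hA : {a : Fin n →₀ ℕ | a.degree = d}.Finite := Finsupp.finite_of_degree_le d |>.subset
    (fun a ha => le_of_eq ha)
  have : ∀ a : Fin n →₀ ℕ, {b : ℕ | r ≤ wdeg w (b, a)}.Finite := by
    intro a
    obtain ⟨N, hN⟩ := exists_nat_gt ((r - ∑ i, w.2 i * (a i : ℝ)) / w.1)
    refine (Set.finite_lt_nat N).subset fun b hb => ?_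
    have hb' : r ≤ w.1 * b + ∑ i, w.2 i * (a i : ℝ) := hb
    rw [div_lt_iff_of_neg hw] at hN
    have h1 : w.1 * N < w.1 * b := by linarith
    have h2 := lt_of_mul_lt_mul_of_nonpos_left h1 hw.le
    exact_mod_cast h2
  refine (hA.biUnion fun a _ => (this a).image fun b => (b, a)).subset ?_
  rintro ⟨b, a⟩ ⟨h1, h2⟩
  exact Set.mem_biUnion (x := a) h1 ⟨b, h2, rfl⟩

end Weights

end LocalGroebner

/-! ### Closedness of homogeneous parts of an ideal in the `t`-adic topology -/

namespace LocalGroebner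

variable {n : ℕ} {R : Type*} [CommRing R]

/-- A fixed `x`-degree leaves finitely many slices, each an arbitrary power series. This builds the
limit of the reduction. -/
theorem exists_cf_eq (c : Expo n → R) (d : ℕ) (hc : ∀ e, c e ≠ 0 → e.2.degree = d) :
    ∃ r : Mixed n R, ∀ e, cf r e = c e := by
  classical
  refine ⟨∑ a ∈ (Finsupp.finite_of_degree_eq d).toFinset,
    MvPolynomial.monomial a (PowerSeries.mk fun b => c (b, a)), fun e => ?_⟩
  rw [cf_sum]
  simp only [cf, MvPolynomial.coeff_monomial]
  rw [Finset.sum_eq_single e.2]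
  · simp
  · intro a _ ha
    simp [ha]
  · intro h
    have h' : ¬ e.2.degree = d := by simpa using h
    simpa using not_not.1 (mt (hc e) h')

/-- A form of Krull's intersection theorem: submodules are closed in finitely generated modules. -/
theorem mem_of_forall_sub_pow_smul_mem {A M : Type*} [CommRing A] [IsNoetherianRing A]
    [AddCommGroup M] [Module A M] {N J : Submodule A M} (hN : N.FG) {t : A}
    (ht : t ∈ Ideal.jacobson (⊥ : Ideal A)) {x : M} (hx : x ∈ N)
    (h : ∀ k : ℕ, ∃ s ∈ N, x - t ^ k • s ∈ J) : x ∈ J := by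
  have : Module.Finite A N := Module.Finite.iff_fg.2 hN
  let J' : Submodule A N := J.comap N.subtype
  have hT : Ideal.span {t} ≤ Ideal.jacobson ⊥ := (Ideal.span_singleton_le_iff_mem _).2 ht
  -- Krull is applied to the quotient of `N` by its intersection with `J`: the class of `x` is
  -- divisible by every power of `t`, hence zero.
  have hkrull := Ideal.iInf_pow_smul_eq_bot_of_le_jacobson (M := N ⧸ J') (Ideal.span {t}) hT
  have hx' : J'.mkQ ⟨x, hx⟩ ∈ (⨅ i : ℕ, Ideal.span {t} ^ i • ⊤ : Submodule A (N ⧸ J')) := by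
    rw [Submodule.mem_iInf]
    intro k
    obtain ⟨s, hs, hsJ⟩ := h k
    have heq : J'.mkQ ⟨x, hx⟩ = t ^ k • J'.mkQ ⟨s, hs⟩ := by
      rw [← map_smul, ← sub_eq_zero, ← map_sub, Submodule.mkQ_apply, Submodule.Quotient.mk_eq_zero]
      exact hsJ
    rw [heq]
    exact Submodule.smul_mem_smul (Ideal.pow_mem_pow (Ideal.mem_span_singleton_self _) k) trivial
  rw [hkrull, Submodule.mem_bot, Submodule.mkQ_apply, Submodule.Quotient.mk_eq_zero] at hx'
  exact hx'

theorem mem_span_monomial_of_cf {f : Mixed n R} {d : ℕ} (hf : ∀ e, cf f e ≠ 0 → e.2.degree = d) :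
    f ∈ Submodule.span (PowerSeries R) ((fun a => (MvPolynomial.monomial a 1 : Mixed n R)) ''
      {a : Fin n →₀ ℕ | a.degree = d}) := by
  rw [f.as_sum]
  refine sum_mem fun a ha => ?_
  have : MvPolynomial.monomial a (MvPolynomial.coeff a f) =
      (MvPolynomial.coeff a f) • (MvPolynomial.monomial a (1 : PowerSeries R)) := by
    simp [MvPolynomial.smul_monomial]
  rw [this]
  refine Submodule.smul_mem _ _ (Submodule.subset_span ⟨a, ?_, rfl⟩)
  obtain ⟨b, hb⟩ :=
    PowerSeries.exists_coeff_ne_zero_iff_ne_zero.2 (MvPolynomial.mem_support_iff.1 ha)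
  exact hf (b, a) hb

theorem cf_homogeneousComponent (d : ℕ) (f : Mixed n R) (e : Expo n) :
    cf (MvPolynomial.homogeneousComponent d f) e = if e.2.degree = d then cf f e else 0 := by
  simp only [cf, MvPolynomial.coeff_homogeneousComponent]
  split_ifs <;> simp

theorem degree_eq_of_cf_homogeneousComponent_ne_zero {d : ℕ} {f : Mixed n R} {e : Expo n}
    (h : cf (MvPolynomial.homogeneousComponent d f) e ≠ 0) : e.2.degree = d := by
  by_contra hne
  exact h (by rw [cf_homogeneousComponent, if_neg hne])

/-- The `x`-homogeneous part of an ideal is closed in the `t`-adic topology. -/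
theorem mem_of_forall_approx [IsNoetherianRing R] (I : Ideal (Mixed n R)) (d : ℕ) {r : Mixed n R}
    (hr : ∀ e, cf r e ≠ 0 → e.2.degree = d)
    (h : ∀ N : ℕ, ∃ f ∈ I, (∀ e, cf f e ≠ 0 → e.2.degree = d) ∧ ∀ e, e.1 < N → cf f e = cf r e) :
    r ∈ I := by
  -- `X * y + 1` has constant coefficient 1, hence is a unit.
  have hX : (PowerSeries.X : PowerSeries R) ∈ Ideal.jacobson (⊥ : Ideal (PowerSeries R)) := by
    rw [Ideal.mem_jacobson_bot]
    intro y
    rw [PowerSeries.isUnit_iff_constantCoeff]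
    simp
  refine mem_of_forall_sub_pow_smul_mem (J := I.restrictScalars (PowerSeries R))
    (Submodule.fg_span ((Finsupp.finite_of_degree_eq d).image _)) hX
    (mem_span_monomial_of_cf hr) fun N => ?_
  obtain ⟨f, hfI, hfd, hfr⟩ := h N
  have hdvd : MvPolynomial.C (PowerSeries.X ^ N : PowerSeries R) ∣ r - f := by
    rw [MvPolynomial.C_dvd_iff_dvd_coeff]
    intro a
    rw [PowerSeries.X_pow_dvd_iff]
    intro b hb
    have : cf (r - f) (b, a) = 0 := by rw [cf_sub, hfr _ hb, sub_self]
    exact this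
  obtain ⟨s, hs⟩ := hdvd
  -- The degree `d` component of the cofactor `s` lies in the finitely generated module to which
  -- Krull applies, and `r - f` is itself of degree `d`.
  refine ⟨MvPolynomial.homogeneousComponent d s,
    mem_span_monomial_of_cf fun e he => degree_eq_of_cf_homogeneousComponent_ne_zero he, ?_⟩
  have hs' : (PowerSeries.X ^ N : PowerSeries R) • MvPolynomial.homogeneousComponent d s =
      r - f := by
    rw [MvPolynomial.smul_eq_C_mul, ← MvPolynomial.homogeneousComponent_C_mul, ← hs]
    refine mixed_ext fun e => ?_
    rw [cf_homogeneousComponent]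
    split_ifs with he
    · rfl
    · rw [cf_sub, not_not.1 (mt (hr e) he), not_not.1 (mt (hfd e) he), sub_self]
  rw [hs']
  simpa using hfI

theorem IsXHomogeneous.homogeneousComponent_mem {I : Ideal (Mixed n R)} (hI : IsXHomogeneous I)
    {f : Mixed n R} (hf : f ∈ I) (d : ℕ) : MvPolynomial.homogeneousComponent d f ∈ I := by
  let _ := MvPolynomial.gradedAlgebra (σ := Fin n) (R := PowerSeries R)
  obtain ⟨S, hS, rfl⟩ := hI
  refine MvPolynomial.homogeneousComponent_mem_of_mem (Ideal.homogeneous_span _ S ?_) hf d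
  intro g hg
  obtain ⟨k, hk⟩ := hS g hg
  exact ⟨k, hk⟩

/-! ### Reduction along the weighted ordering -/

section Reduction

variable {ord ord' : MonOrdering n} {w : ℝ × (Fin n → ℝ)} {I : Ideal (Mixed n R)}
  {G : Set (Mixed n R)}

/-- Every term of the leading ideal of `G` is the leading term, with respect to both orderings, of
an `x`-homogeneous element of `I`, provided that this holds for the leading terms of `G`. -/
theorem exists_mem_of_mem_ltIdeal (hGI : G ⊆ I)
    (hlead : ∀ g ∈ G, g = 0 ∨ ∃ e, IsLeadingMon ord g e ∧ IsLeadingMon ord' g e ∧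
      ∀ e', cf g e' ≠ 0 → e'.2.degree = e.2.degree)
    {p : Poly n R} (hp : p ∈ ltIdeal ord G) (e : Expo n) :
    ∃ h ∈ I, cf h e = cf (incl p) e ∧
      ∀ e', cf h e' ≠ 0 → e'.2.degree = e.2.degree ∧ (e' = e ∨ ord'.gt e e') := by
  -- The coefficient at `e` may vanish, so the claim is additive in `p` and cancellation does no
  -- harm.
  refine span_term_induction (P := fun p => ∀ e, ∃ h ∈ I, cf h e = cf (incl p) e ∧
      ∀ e', cf h e' ≠ 0 → e'.2.degree = e.2.degree ∧ (e' = e ∨ ord'.gt e e')) ?_ ?_ ?_ ?_ hp e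
  · rintro _ ⟨g, hg, rfl⟩ e
    rcases hlead g hg with rfl | ⟨e', h1, h2, h3⟩
    · exact ⟨0, I.zero_mem, by simp [lt_zero], by simp⟩
    · rw [h1.lt_eq, cf_incl_term]
      by_cases h : e' = e
      · subst h
        refine ⟨g, hGI hg, by simp, fun e'' he'' => ⟨h3 _ he'', ?_⟩⟩
        by_cases hne : e'' = e'
        · exact Or.inl hne
        · exact Or.inr (h2.2 _ he'' hne)
      · exact ⟨0, I.zero_mem, by simp [h], by simp⟩
  · exact fun e => ⟨0, I.zero_mem, by simp, by simp⟩
  · intro p q hp hq e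
    obtain ⟨h, h1, h2, h3⟩ := hp e
    obtain ⟨k, k1, k2, k3⟩ := hq e
    refine ⟨h + k, I.add_mem h1 k1, by rw [cf_add, h2, k2, map_add, cf_add], fun e' he' => ?_⟩
    by_cases h0 : cf h e' = 0
    · exact k3 e' (by simpa [h0] using he')
    · exact h3 e' h0
  · intro e₀ c p hp e
    by_cases he : cf (incl (term e₀ c * p)) e = 0
    · exact ⟨0, I.zero_mem, by rw [he, cf_zero], by simp⟩
    · rw [map_mul] at he
      obtain ⟨e₁, rfl⟩ := exists_of_cf_term_mul_ne_zero he
      obtain ⟨h, h1, h2, h3⟩ := hp e₁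
      refine ⟨incl (term e₀ c) * h, I.mul_mem_left _ h1, ?_, fun e' he' => ?_⟩
      · rw [map_mul, cf_term_mul_add, cf_term_mul_add, h2]
      · obtain ⟨e₂, rfl⟩ := exists_of_cf_term_mul_ne_zero he'
        rw [cf_term_mul_add] at he'
        obtain ⟨h4, h5⟩ := h3 e₂ (right_ne_zero_of_mul he')
        refine ⟨by simp [h4], h5.imp (fun h => by rw [h]) fun h => ?_⟩
        rw [add_comm e₀, add_comm e₀]
        exact ord'.gt_mul _ _ _ h

/-- The number of greater monomials of the same degree in `x`, with respect to the weighted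
ordering. -/
noncomputable def weightedRank (ord : MonOrdering n) (w : ℝ × (Fin n → ℝ)) (e : Expo n) : ℕ :=
  {e' : Expo n | e'.2.degree = e.2.degree ∧ (ord.weighted w).gt e' e}.ncard

/-- The monomials above `e` are also above `e'`, and so is `e` itself; `ncard` is strictly monotone
here because the larger set is finite. -/
theorem weightedRank_lt (hw : w.1 < 0) {e e' : Expo n} (hd : e'.2.degree = e.2.degree)
    (h : (ord.weighted w).gt e e') : weightedRank ord w e < weightedRank ord w e' := by
  refine Set.ncard_lt_ncard ⟨fun a ha => ⟨ha.1.trans hd.symm, (ord.weighted w).trans _ _ _ ha.2 h⟩,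
    fun hsub => ?_⟩ ?_
  · exact (ord.weighted w).irrefl e (hsub ⟨hd.symm, h⟩).2
  · refine (finite_setOf_wdeg_le hw e'.2.degree (wdeg w e')).subset fun a ha => ⟨ha.1, ?_⟩
    exact ha.2.elim le_of_lt fun h => h.1.le

theorem eq_of_weightedRank_eq (hw : w.1 < 0) {e e' : Expo n} (hd : e'.2.degree = e.2.degree)
    (h : weightedRank ord w e = weightedRank ord w e') : e = e' := by
  rcases (ord.weighted w).total e e' with h' | h' | h'
  · exact absurd h (weightedRank_lt hw hd h').ne
  · exact h'
  · exact absurd h (weightedRank_lt hw hd.symm h').ne'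

/-- One step of the reduction: the term of rank `k` is removed if it lies in the leading ideal,
without changing the terms of smaller rank. -/
theorem exists_reduce_rank (hw : w.1 < 0) (hGI : G ⊆ I)
    (hlead : ∀ g ∈ G, g = 0 ∨ ∃ e, IsLeadingMon ord g e ∧ IsLeadingMon (ord.weighted w) g e ∧
      ∀ e', cf g e' ≠ 0 → e'.2.degree = e.2.degree)
    (d k : ℕ) (f : {f : Mixed n R // f ∈ I ∧ ∀ e, cf f e ≠ 0 → e.2.degree = d}) :
    ∃ f' : {f : Mixed n R // f ∈ I ∧ ∀ e, cf f e ≠ 0 → e.2.degree = d},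
      (∀ e, e.2.degree = d → weightedRank ord w e < k → cf f'.1 e = cf f.1 e) ∧
      ∀ e, e.2.degree = d → weightedRank ord w e = k →
        term e (cf f'.1 e) ∈ ltIdeal ord G → cf f'.1 e = 0 := by
  obtain ⟨f, hfI, hfd⟩ := f
  by_cases hex : ∃ e, e.2.degree = d ∧ weightedRank ord w e = k ∧ term e (cf f e) ∈ ltIdeal ord G
  · obtain ⟨e, hed, hek, heL⟩ := hex
    -- Subtracting `h` cancels the term at `e`; all other monomials of `h` are smaller, so of rank
    -- above `k`.
    obtain ⟨h, hI, h1, h2⟩ := exists_mem_of_mem_ltIdeal hGI hlead heL e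
    rw [cf_incl_term, if_pos rfl] at h1
    refine ⟨⟨f - h, I.sub_mem hfI hI, fun e' he' => ?_⟩, fun e' hd' hk' => ?_, fun e' hd' hk' _ => ?_⟩
    · by_cases h0 : cf h e' = 0
      · exact hfd e' (by simpa [h0] using he')
      · exact (h2 e' h0).1.trans hed
    · rw [cf_sub, sub_eq_self]
      by_contra h0
      rcases (h2 e' h0).2 with rfl | hgt
      · omega
      · have := weightedRank_lt hw (hd'.trans hed.symm) hgt
        omega
    · obtain rfl := eq_of_weightedRank_eq hw (hed.trans hd'.symm) (hk'.trans hek.symm)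
      rw [cf_sub, h1, sub_self]
  · exact ⟨⟨f, hfI, hfd⟩, fun _ _ _ => rfl, fun e hd hk h => absurd ⟨e, hd, hk, h⟩ hex⟩

/-- An `x`-homogeneous element whose leading term with respect to the weighted ordering is
irreducible has a nonzero fully reduced remainder in the ideal. -/
theorem exists_reduced [IsNoetherianRing R] (hw : w.1 < 0) (hGI : G ⊆ I)
    (hlead : ∀ g ∈ G, g = 0 ∨ ∃ e, IsLeadingMon ord g e ∧ IsLeadingMon (ord.weighted w) g e ∧
      ∀ e', cf g e' ≠ 0 → e'.2.degree = e.2.degree)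
    {f : Mixed n R} (hf : f ∈ I) {e : Expo n} (he : IsLeadingMon (ord.weighted w) f e)
    (hfd : ∀ e', cf f e' ≠ 0 → e'.2.degree = e.2.degree)
    (hirr : term e (cf f e) ∉ ltIdeal ord G) :
    ∃ r ∈ I, r ≠ 0 ∧ ∀ e, cf r e ≠ 0 → term e (cf r e) ∉ ltIdeal ord G := by
  set d := e.2.degree with hd
  -- Below rank `m`, `f` has at most its irreducible leading term. Starting at rank `m` therefore
  -- suffices and keeps the coefficient at `e`.
  set m := weightedRank ord w e + 1 with hm
  choose F hF1 hF2 using fun k => exists_reduce_rank (ord := ord) hw hGI hlead d k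
  let s : ℕ → {f : Mixed n R // f ∈ I ∧ ∀ e, cf f e ≠ 0 → e.2.degree = d} :=
    fun j => Nat.rec ⟨f, hf, hfd⟩ (fun j fj => F (m + j) fj) j
  have hstep : ∀ j, s (j + 1) = F (m + j) (s j) := fun _ => rfl
  have hconst : ∀ i j, i ≤ j → ∀ e, e.2.degree = d → weightedRank ord w e < m + i →
      cf (s j).1 e = cf (s i).1 e := by
    intro i j hij e he hr
    induction j, hij using Nat.le_induction with
    | base => rfl
    | succ j hj ih => rw [hstep, hF1 _ _ e he (by omega), ih]
  have hred : ∀ j e, e.2.degree = d → weightedRank ord w e < m + j →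
      term e (cf (s j).1 e) ∈ ltIdeal ord G → cf (s j).1 e = 0 := by
    intro j
    induction j with
    | zero =>
      intro e' hd' hr hL
      by_contra h0
      change cf f e' ≠ 0 at h0
      by_cases hne : e' = e
      · exact hirr (hne ▸ hL)
      · have := weightedRank_lt hw hd' (he.2 e' h0 hne)
        omega
    | succ j ih =>
      intro e' hd' hr hL
      rcases Nat.lt_or_ge (weightedRank ord w e') (m + j) with hlt | hge
      · rw [hconst j (j + 1) (by omega) e' hd' hlt] at hL ⊢
        exact ih e' hd' hlt hL
      · rw [hstep] at hL ⊢
        exact hF2 _ _ e' hd' (by omega) hL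
  classical
  -- The limit: a coefficient of rank `k` is final from `s k` on, because `k < m + k`.
  obtain ⟨r, hr⟩ := exists_cf_eq
    (fun e : Expo n => if e.2.degree = d then cf (s (weightedRank ord w e)).1 e else 0) d
    (fun e he => by by_contra h; simp [h] at he)
  have hrd : ∀ e, cf r e ≠ 0 → e.2.degree = d := by
    intro e he
    by_contra h
    simp [hr, h] at he
  refine ⟨r, mem_of_forall_approx I d hrd fun N => ?_, ?_, ?_⟩
  -- The finitely many monomials below `t ^ N` have bounded rank, so some `s K` agrees with `r` on
  -- all of them.
  · have hfin : {e : Expo n | e.1 < N ∧ e.2.degree = d}.Finite :=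
      (Set.finite_lt_nat N).prod (Finsupp.finite_of_degree_eq d)
    obtain ⟨K, hK⟩ := (hfin.image (weightedRank ord w)).bddAbove
    refine ⟨(s K).1, (s K).2.1, (s K).2.2, fun e he => ?_⟩
    rw [hr]
    split_ifs with h
    · exact hconst _ _ (hK ⟨e, ⟨he, h⟩, rfl⟩) e h (by omega)
    · exact not_not.1 (mt ((s K).2.2 e) h)
  · rintro rfl
    have h1 := hr e
    rw [cf_zero, if_pos hd.symm, hconst 0 _ (Nat.zero_le _) e rfl (by omega)] at h1
    exact he.1 h1.symm
  · intro e he hL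
    have hed := hrd e he
    rw [hr, if_pos hed] at he hL
    exact he (hred _ e hed (by omega) hL)

/-- The two orderings meet here: the remainder is produced along the weighted ordering, and its
leading term for `ord` gives the contradiction. -/
theorem term_mem_ltIdeal_of_isLeadingMon_weighted [IsNoetherianRing R] (hord : ord.IsTLocal)
    (hw : w.1 < 0) (hG : IsStandardBasis ord G I)
    (hlead : ∀ g ∈ G, g = 0 ∨ ∃ e, IsLeadingMon ord g e ∧ IsLeadingMon (ord.weighted w) g e ∧
      ∀ e', cf g e' ≠ 0 → e'.2.degree = e.2.degree)
    {f : Mixed n R} (hf : f ∈ I) {e : Expo n} (he : IsLeadingMon (ord.weighted w) f e)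
    (hfd : ∀ e', cf f e' ≠ 0 → e'.2.degree = e.2.degree) :
    term e (cf f e) ∈ ltIdeal ord G := by
  by_contra hirr
  obtain ⟨r, hrI, hr0, hr⟩ := exists_reduced hw hG.2.1 hlead hf he hfd hirr
  obtain ⟨e', he'⟩ := exists_isLeadingMon hord hr0
  exact hr e' he'.1 (hG.2.2 ▸ he'.term_mem_ltIdeal hrI)

end Reduction

end LocalGroebner

namespace LocalGroebner

variable {n : ℕ} {R : Type*} [CommRing R] {ord : MonOrdering n} {w : ℝ × (Fin n → ℝ)}
  {I : Ideal (Mixed n R)} {G : Set (Mixed n R)}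

/-! ### Lowest terms of slices -/

section Slices

theorem isLeadingMon_C (hord : ord.IsTLocal) {φ : PowerSeries R} (hφ : φ ≠ 0) :
    IsLeadingMon ord (MvPolynomial.C φ : Mixed n R) (φ.order.toNat, 0) := by
  have h0 : ∀ b, cf (MvPolynomial.C φ : Mixed n R) (b, 0) = PowerSeries.coeff b φ := by
    simp [cf]
  refine ⟨by rw [h0]; exact PowerSeries.coeff_order hφ, ?_⟩
  rintro ⟨b, a⟩ he hne
  by_cases ha : a = 0
  · subst ha
    rw [h0] at he
    have hle : φ.order.toNat ≤ b := ENat.toNat_le_of_le_natCast (PowerSeries.order_le b he)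
    exact hord.gt_of_lt (lt_of_le_of_ne hle fun h => hne (by rw [h])) 0
  · simp [cf, MvPolynomial.coeff_C, Ne.symm ha] at he

open Classical in
-- As `1 > t`, the leading term of a power series is its term of lowest order.
theorem cf_incl_slicewiseLt (hord : ord.IsTLocal) (g : Mixed n R) (e : Expo n) :
    cf (incl (slicewiseLt ord g)) e = if ∀ b < e.1, cf g (b, e.2) = 0 then cf g e else 0 := by
  have hterm : ∀ a ∈ g.support, lt ord (MvPolynomial.C (MvPolynomial.coeff a g) : Mixed n R) *
      term (0, a) 1 = term ((MvPolynomial.coeff a g).order.toNat, a)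
        (cf g ((MvPolynomial.coeff a g).order.toNat, a)) := by
    intro a ha
    rw [(isLeadingMon_C hord (MvPolynomial.mem_support_iff.1 ha)).lt_eq, term_mul_term, mul_one]
    simp [cf]
  obtain ⟨b, a⟩ := e
  rw [slicewiseLt, Finset.sum_congr rfl hterm, map_sum, cf_sum]
  simp only [cf_incl_term]
  rw [Finset.sum_eq_single a (fun a' _ hne => if_neg fun h => hne (congrArg Prod.snd h))]
  · by_cases hb : (MvPolynomial.coeff a g).order.toNat = b
    · subst hb
      rw [if_pos rfl, if_pos]
      intro b' hb'
      exact PowerSeries.coeff_of_lt_order_toNat b' hb'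
    · rw [if_neg fun h => hb (congrArg Prod.fst h)]
      split_ifs with h
      · by_contra h0
        have h0' : cf g (b, a) ≠ 0 := fun h => h0 h.symm
        have hle : (MvPolynomial.coeff a g).order.toNat ≤ b :=
          ENat.toNat_le_of_le_natCast (PowerSeries.order_le b h0')
        have hne : MvPolynomial.coeff a g ≠ 0 := fun h => h0' (by simp [cf, h])
        exact PowerSeries.coeff_order hne (h _ (lt_of_le_of_ne hle hb))
      · rfl
  · intro ha
    have : MvPolynomial.coeff a g = 0 := MvPolynomial.notMem_support_iff.1 ha
    simp [cf, this]

theorem IsLeadingMon.cf_eq_zero_of_lt (hord : ord.IsTLocal) {f : Mixed n R} {e : Expo n}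
    (h : IsLeadingMon ord f e) {b : ℕ} (hb : b < e.1) : cf f (b, e.2) = 0 := by
  by_contra h0
  have hgt : ord.gt (b, e.2) e := hord.gt_of_lt hb e.2
  have hne : (b, e.2) ≠ e := fun h => ord.irrefl e (by rwa [h] at hgt)
  exact ord.irrefl _ (ord.trans _ _ _ (h.2 _ h0 hne) hgt)

theorem IsLeadingMon.slicewiseLt (hord : ord.IsTLocal) {g : Mixed n R} {e : Expo n}
    (h : IsLeadingMon ord g e) : IsLeadingMon ord (incl (slicewiseLt ord g)) e := by
  classical
  refine h.congr ?_ fun e' he' h0 => he' ?_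
  · rw [cf_incl_slicewiseLt hord, if_pos fun b hb => h.cf_eq_zero_of_lt hord hb]
  · rw [cf_incl_slicewiseLt hord, h0, ite_self]

theorem cf_eq_zero_of_mem_maxSupport (hw : w.1 < 0) {g : Mixed n R} {e : Expo n}
    (he : e ∈ maxSupport w g) {b : ℕ} (hb : b < e.1) : cf g (b, e.2) = 0 := by
  by_contra h0
  exact (he.2 _ h0).not_gt (wdeg_lt_wdeg hw hb e.2)

/-- Since `w₀ < 0`, a slice contains at most one monomial of maximal weight. For initial forms,
being initially reduced is thus plain reducedness. -/
theorem slicewiseLt_initialForm (hord : ord.IsTLocal) (hw : w.1 < 0) (g : Mixed n R) :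
    slicewiseLt ord (incl (initialForm w g)) = initialForm w g := by
  classical
  refine incl_injective (mixed_ext fun e => ?_)
  rw [cf_incl_slicewiseLt hord]
  split_ifs with h
  · rfl
  · by_contra h0
    have he : e ∈ maxSupport w g := by
      by_contra hne
      exact h0 (by rw [cf_incl_initialForm hw, if_neg hne])
    refine h fun b hb => ?_
    rw [cf_incl_initialForm hw, cf_eq_zero_of_mem_maxSupport hw he hb, ite_self]

end Slices

/-! ### Consequences of initial reducedness -/

section InitiallyReduced

/-- A term lowest in its slice survives in `g'`, whose leading monomial is that of `g`; so it
belongs to the tail of `g'`. -/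
theorem IsInitiallyReducedWrt.term_notMem (hord : ord.IsTLocal) {H : Set (Mixed n R)}
    (hR : IsInitiallyReducedWrt ord G H) {g : Mixed n R} (hg : g ∈ G) {e e' : Expo n}
    (he : IsLeadingMon ord g e) (hne : e' ≠ e) (he' : cf g e' ≠ 0)
    (hslice : ∀ b < e'.1, cf g (b, e'.2) = 0) : term e' (cf g e') ∉ ltIdeal ord H := by
  classical
  have h := hR _ ⟨g, hg, rfl⟩ e'
  simp only [(he.slicewiseLt hord).cf_tail, if_neg hne, cf_incl_slicewiseLt hord,
    if_pos hslice] at h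
  exact h he'

/-- The elements of an initially reduced standard basis of an `x`-homogeneous ideal are
`x`-homogeneous. -/
theorem IsInitiallyReducedStandardBasis.degree_eq (hord : ord.IsTLocal) (hI : IsXHomogeneous I)
    (hG : IsInitiallyReducedStandardBasis ord G I) {g : Mixed n R} (hg : g ∈ G) {e e' : Expo n}
    (he : IsLeadingMon ord g e) (he' : cf g e' ≠ 0) : e'.2.degree = e.2.degree := by
  by_contra hne
  set f := MvPolynomial.homogeneousComponent e'.2.degree g with hf
  have hfI : f ∈ I := hI.homogeneousComponent_mem (hG.1.2.1 hg) _
  have hf0 : f ≠ 0 := fun h0 => he' (by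
    have h1 := cf_homogeneousComponent e'.2.degree g e'
    rwa [← hf, h0, cf_zero, if_pos rfl, eq_comm] at h1)
  obtain ⟨e₁, he₁⟩ := exists_isLeadingMon hord hf0
  have hd : e₁.2.degree = e'.2.degree := degree_eq_of_cf_homogeneousComponent_ne_zero he₁.1
  -- A homogeneous component consists of whole slices, so the leading term of `f` is also lowest in
  -- its slice of `g`.
  have hcf : ∀ b, cf f (b, e₁.2) = cf g (b, e₁.2) := fun b => by
    rw [hf, cf_homogeneousComponent, if_pos hd]
  have hmem := he₁.term_mem_ltIdeal hfI
  rw [← hG.1.2.2, show cf f e₁ = cf g e₁ from hcf e₁.1] at hmem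
  refine hG.2.2.term_notMem hord hg he (fun h => hne (by rw [← hd, h])) ?_ (fun b hb => ?_) hmem
  · rw [← show cf f e₁ = cf g e₁ from hcf e₁.1]
    exact he₁.1
  · rw [← hcf]
    exact he₁.cf_eq_zero_of_lt hord hb

theorem MonOrdering.isTLocal_weighted (ord : MonOrdering n) (hw : w.1 < 0) :
    (ord.weighted w).IsTLocal :=
  Or.inl (wdeg_lt_wdeg hw Nat.zero_lt_one 0)

/-- The leading monomial for the weighted ordering, which is again `t`-local, has maximal weight. -/
theorem maxSupport_nonempty (ord : MonOrdering n) (hw : w.1 < 0) {f : Mixed n R} (hf : f ≠ 0) :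
    (maxSupport w f).Nonempty := by
  obtain ⟨e, he⟩ := exists_isLeadingMon (ord.isTLocal_weighted hw) hf
  refine ⟨e, he.1, fun e' he' => ?_⟩
  by_cases h : e' = e
  · rw [h]
  · exact (he.2 e' he' h).elim le_of_lt fun h => h.1.le

/-- For weights `v` with `in_v(I) = lt(I)`, the leading monomials of an initially reduced standard
basis have maximal weighted degree. -/
theorem IsInitiallyReducedStandardBasis.wdeg_le_of_initialIdeal_eq (hord : ord.IsTLocal)
    (hG : IsInitiallyReducedStandardBasis ord G I) {v : ℝ × (Fin n → ℝ)} (hv : v.1 < 0)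
    (hvI : initialIdeal v I = ltIdeal ord (I : Set (Mixed n R))) {g : Mixed n R} (hg : g ∈ G)
    {e : Expo n} (he : IsLeadingMon ord g e) {e' : Expo n} (he' : cf g e' ≠ 0) :
    wdeg v e' ≤ wdeg v e := by
  classical
  obtain ⟨e₁, he₁⟩ := maxSupport_nonempty ord hv (f := g) (by rintro rfl; exact he.1 (cf_zero e))
  by_cases h : e₁ = e
  · exact h ▸ he₁.2 e' he'
  -- As lt(G) is generated by terms, it contains the term at `e₁`, which reducedness forbids.
  · have hin : initialForm v g ∈ ltIdeal ord G := by
      rw [hG.1.2.2, ← hvI]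
      exact Ideal.subset_span ⟨g, hG.1.2.1 hg, rfl⟩
    have hmem := LocalGroebner.term_mem_ltIdeal hin e₁
    rw [cf_incl_initialForm hv, if_pos he₁] at hmem
    exact absurd hmem (hG.2.2.term_notMem hord hg he h he₁.1
      fun b hb => cf_eq_zero_of_mem_maxSupport hv he₁ hb)

/-- The inequality is a closed condition on the weight, so it passes to the closure. -/
theorem IsInitiallyReducedStandardBasis.wdeg_le (hord : ord.IsTLocal)
    (hG : IsInitiallyReducedStandardBasis ord G I) (hw : w ∈ groebnerCone ord I) {g : Mixed n R}
    (hg : g ∈ G) {e : Expo n} (he : IsLeadingMon ord g e) {e' : Expo n} (he' : cf g e' ≠ 0) :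
    wdeg w e' ≤ wdeg w e := by
  refine closure_minimal (t := {v | wdeg v e' ≤ wdeg v e}) (fun v hv => ?_)
    (isClosed_le (continuous_wdeg e') (continuous_wdeg e)) hw
  exact hG.wdeg_le_of_initialIdeal_eq hord hv.1 hv.2 hg he he'

end InitiallyReduced

/-! ### Lifting elements of the initial ideal -/

section InitialIdeal

/-- The component of an element of the initial ideal of `x`-degree `d` and weighted degree `D` is
that of an `x`-homogeneous element of the ideal of weighted degree at most `D`. -/
theorem exists_mem_of_mem_initialIdeal (hw : w.1 < 0) (hI : IsXHomogeneous I) {p : Poly n R}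
    (hp : p ∈ initialIdeal w I) (d : ℕ) (D : ℝ) :
    ∃ f ∈ I, (∀ e, cf f e ≠ 0 → e.2.degree = d ∧ wdeg w e ≤ D) ∧
      ∀ e, e.2.degree = d → wdeg w e = D → cf f e = cf (incl p) e := by
  classical
  refine span_term_induction (P := fun p => ∀ d D,
    ∃ f ∈ I, (∀ e, cf f e ≠ 0 → e.2.degree = d ∧ wdeg w e ≤ D) ∧
      ∀ e, e.2.degree = d → wdeg w e = D → cf f e = cf (incl p) e) ?_ ?_ ?_ ?_ hp d D
  · rintro _ ⟨f, hf, rfl⟩ d D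
    -- Unless `D` is the maximal weight of `f`, the initial form has no terms of weight `D` and zero
    -- is a lift.
    by_cases hex : ∃ e ∈ maxSupport w f, wdeg w e = D
    · obtain ⟨e₀, he₀, rfl⟩ := hex
      refine ⟨MvPolynomial.homogeneousComponent d f, hI.homogeneousComponent_mem hf d,
        fun e he => ?_, fun e hd hD => ?_⟩
      · have hd := degree_eq_of_cf_homogeneousComponent_ne_zero he
        rw [cf_homogeneousComponent, if_pos hd] at he
        exact ⟨hd, he₀.2 e he⟩
      · rw [cf_homogeneousComponent, if_pos hd, cf_incl_initialForm hw]
        split_ifs with h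
        · rfl
        · by_contra h0
          exact h ⟨h0, fun e' he' => hD ▸ he₀.2 e' he'⟩
    · refine ⟨0, I.zero_mem, by simp, fun e _ hD => ?_⟩
      rw [cf_zero, cf_incl_initialForm hw, if_neg fun he => hex ⟨e, he, hD⟩]
  · exact fun d D => ⟨0, I.zero_mem, by simp, by simp⟩
  · intro p q hp hq d D
    obtain ⟨f, hf, hf1, hf2⟩ := hp d D
    obtain ⟨g, hg, hg1, hg2⟩ := hq d D
    refine ⟨f + g, I.add_mem hf hg, fun e he => ?_, fun e hd hD => ?_⟩
    · by_cases h0 : cf f e = 0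
      · exact hg1 e (by simpa [h0] using he)
      · exact hf1 e h0
    · rw [cf_add, hf2 e hd hD, hg2 e hd hD, map_add, cf_add]
  · intro e₀ c p hp d D
    -- This makes the truncated subtraction of degrees exact; otherwise no multiple of the term has
    -- monomials of `x`-degree `d`.
    by_cases hd₀ : e₀.2.degree ≤ d
    · obtain ⟨f, hf, hf1, hf2⟩ := hp (d - e₀.2.degree) (D - wdeg w e₀)
      refine ⟨incl (term e₀ c) * f, I.mul_mem_left _ hf, fun e he => ?_, fun e hd hD => ?_⟩
      · obtain ⟨e', rfl⟩ := exists_of_cf_term_mul_ne_zero he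
        rw [cf_term_mul_add] at he
        obtain ⟨h1, h2⟩ := hf1 e' (right_ne_zero_of_mul he)
        rw [wdeg_add, Prod.snd_add, map_add]
        exact ⟨by omega, by linarith⟩
      · by_cases hex : ∃ e', e = e₀ + e'
        · obtain ⟨e', rfl⟩ := hex
          rw [wdeg_add] at hD
          rw [Prod.snd_add, map_add] at hd
          rw [map_mul, cf_term_mul_add, cf_term_mul_add, hf2 e' (by omega) (by linarith)]
        · rw [map_mul, not_not.1 (mt exists_of_cf_term_mul_ne_zero hex),
            not_not.1 (mt exists_of_cf_term_mul_ne_zero hex)]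
    · refine ⟨0, I.zero_mem, by simp, fun e hd _ => ?_⟩
      rw [cf_zero, eq_comm, map_mul]
      by_contra h0
      obtain ⟨e', rfl⟩ := exists_of_cf_term_mul_ne_zero h0
      rw [Prod.snd_add, map_add] at hd
      omega

/-- Leading terms of the initial ideal are leading terms with respect to the weighted ordering. -/
theorem exists_isLeadingMon_weighted (hw : w.1 < 0) (hI : IsXHomogeneous I) {p : Poly n R}
    (hp : p ∈ initialIdeal w I) {e : Expo n} (he : IsLeadingMon ord (incl p) e) :
    ∃ f ∈ I, cf f e = cf (incl p) e ∧ IsLeadingMon (ord.weighted w) f e ∧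
      ∀ e', cf f e' ≠ 0 → e'.2.degree = e.2.degree := by
  obtain ⟨f, hf, h1, h2⟩ := exists_mem_of_mem_initialIdeal hw hI hp e.2.degree (wdeg w e)
  have hcf := h2 e rfl rfl
  refine ⟨f, hf, hcf, ⟨hcf ▸ he.1, fun e' he' hne => ?_⟩, fun e' he' => (h1 e' he').1⟩
  obtain ⟨hd, hle⟩ := h1 e' he'
  -- A monomial of smaller weight loses by weight; one of equal weight occurs in `p` and loses by
  -- `ord`.
  rcases hle.lt_or_eq with hlt | heq
  · exact Or.inl hlt
  · exact Or.inr ⟨heq, he.2 e' (h2 e' hd heq ▸ he') hne⟩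

end InitialIdeal

end LocalGroebner

/-! ### The proposition -/

theorem proposition3p9 {n : ℕ} {R : Type*} [CommRing R] [IsNoetherianRing R]
    (ord : MonOrdering n) (hord : ord.IsTLocal)
    (I : Ideal (Mixed n R)) (hI : IsXHomogeneous I)
    (G : Set (Mixed n R))
    (hG : IsInitiallyReducedStandardBasis ord G (I : Set (Mixed n R)))
    (w : ℝ × (Fin n → ℝ)) (hw : w ∈ groebnerCone ord I) (hw0 : w.1 < 0) :
    IsInitiallyReducedStandardBasis ord (incl '' (initialForm w '' G))
      (incl '' (initialIdeal w I : Set (Poly n R))) := by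
  classical
  have hmax : ∀ g ∈ G, ∀ e, IsLeadingMon ord g e → e ∈ maxSupport w g :=
    fun g hg e he => ⟨he.1, fun e' he' => hG.wdeg_le hord hw hg he he'⟩
  have hinit : ∀ g ∈ G, ∀ e, IsLeadingMon ord g e → IsLeadingMon ord (incl (initialForm w g)) e := by
    intro g hg e he
    refine he.congr ?_ fun e' he' h0 => he' ?_
    · rw [cf_incl_initialForm hw0, if_pos (hmax g hg e he)]
    · rw [cf_incl_initialForm hw0, h0, ite_self]
  have hinit_zero : incl (initialForm w (0 : Mixed n R)) = 0 :=
    mixed_ext fun e => by rw [cf_incl_initialForm hw0, cf_zero, ite_self]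
  have hlt : ∀ g ∈ G, lt ord (incl (initialForm w g)) = lt ord g := by
    intro g hg
    by_cases hg0 : g = 0
    · rw [hg0, hinit_zero]
    · obtain ⟨e, he⟩ := exists_isLeadingMon hord hg0
      rw [he.lt_eq, (hinit g hg e he).lt_eq, cf_incl_initialForm hw0, if_pos (hmax g hg e he)]
  have himage : lt ord '' (incl '' (initialForm w '' G)) = lt ord '' G := by
    rw [Set.image_image, Set.image_image]
    exact Set.image_congr hlt
  have hltG : ltIdeal ord (incl '' (initialForm w '' G)) = ltIdeal ord G := by
    rw [ltIdeal, himage, ltIdeal]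
  have hsub : incl '' (initialForm w '' G) ⊆ incl '' (initialIdeal w I : Set (Poly n R)) := by
    refine Set.image_mono ((Set.image_mono hG.1.2.1).trans ?_)
    exact Ideal.subset_span
  have hlead : ∀ g ∈ G, g = 0 ∨ ∃ e, IsLeadingMon ord g e ∧ IsLeadingMon (ord.weighted w) g e ∧
      ∀ e', cf g e' ≠ 0 → e'.2.degree = e.2.degree := by
    intro g hg
    by_cases hg0 : g = 0
    · exact Or.inl hg0
    · obtain ⟨e, he⟩ := exists_isLeadingMon hord hg0
      refine Or.inr ⟨e, he, ⟨he.1, fun e' he' hne => ?_⟩, fun e' he' => hG.degree_eq hord hI hg he he'⟩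
      rcases (hG.wdeg_le hord hw hg he he').lt_or_eq with h | h
      · exact Or.inl h
      · exact Or.inr ⟨h, he.2 e' he' hne⟩
  have hideal : ltIdeal ord (incl '' (initialIdeal w I : Set (Poly n R))) = ltIdeal ord G := by
    refine le_antisymm (Ideal.span_le.2 ?_) (hltG ▸ Ideal.span_mono (Set.image_mono hsub))
    rintro _ ⟨_, ⟨p, hp, rfl⟩, rfl⟩
    by_cases hp0 : incl p = 0
    · rw [hp0, lt_zero]
      exact zero_mem _
    · obtain ⟨e, he⟩ := exists_isLeadingMon hord hp0
      obtain ⟨f, hf, hfe, hflead, hfd⟩ := exists_isLeadingMon_weighted hw0 hI hp he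
      rw [he.lt_eq, ← hfe]
      exact term_mem_ltIdeal_of_isLeadingMon_weighted hord hw0 hG.1 hlead hf hflead hfd
  refine ⟨⟨(hG.1.1.image _).image _, hsub, hltG.trans hideal.symm⟩, ?_, ?_⟩
  -- Minimality only involves the set of leading terms and the leading ideal, and both are
  -- unchanged.
  · intro T hT
    rw [himage] at hT
    rw [hideal, hG.1.2.2]
    exact hG.2.1 T hT
  · rintro _ ⟨_, ⟨_, ⟨g, hg, rfl⟩, rfl⟩, rfl⟩ e' he'
    -- A tail term of in_w(g) is a non-leading term of `g` that is lowest in its slice, so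
    -- reducedness of `G` applies.
    simp only [slicewiseLt_initialForm hord hw0] at he' ⊢
    rw [hltG]
    by_cases hg0 : g = 0
    · rw [hg0, hinit_zero, tail, lt_zero] at he'
      simp at he'
    · obtain ⟨e, he⟩ := exists_isLeadingMon hord hg0
      rw [(hinit g hg e he).cf_tail] at he' ⊢
      split_ifs at he' ⊢ with hne
      · exact absurd rfl he'
      · rw [cf_incl_initialForm hw0] at he' ⊢
        split_ifs at he' ⊢ with hmem
        · exact hG.2.2.term_notMem hord hg he hne he'
            fun b hb => cf_eq_zero_of_mem_maxSupport hw0 hmem hb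
        · exact absurd rfl he'
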